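/- For $\xi\in\mathbb R$ let $g_\xi(x)=e^{2\pi i\xi x}$ and let $\mathcal F(g_\xi)=(\varphi_n)_{n\in\mathbb Z}$ be the family in $L^2[-1/2,1/2]$ given by $\varphi_n(x)=e^{2\pi i n x}$ for $n\ge 0$ and $\varphi_n(x)=g_\xi(x)e^{2\pi i n x}=e^{2\pi i(\xi+n)x}$ for $n<0$ (a family indexed by $\mathbb Z$: a function that occurs for two indices is counted twice). The family is called complete if $f\in L^2[-1/2,1/2]$ and $\langle f,\varphi_n\rangle=0$ for all $n$ imply $f=0$; a frame if there are constants $0<A\le B<\infty$ with $A\|f\|^2\le\sum_{n\in\mathbb Z}|\langle f,\varphi_n\rangle|^2\le B\|f\|^2$ for all $f\in L^2[-1/2,1/2]$; and a Riesz basis if it is a frame and every $f\in L^2[-1/2,1/2]$ has a unique expansion $f=\sum_{n\in\mathbb Z}\alpha_n\varphi_n$ with $\alpha_n\in\mathbb C$, the series converging unconditionally in $L^2$. Then: - If $\xi<-1/2$, then $\mathcal F(g_\xi)$ is incomplete (not complete). - If $-1/2<\xi<1/2$, then $\mathcal F(g_\xi)$ is a Riesz basis. - If $-1/2+n<\xi<1/2+n$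 for some integer $n\ge 1$, then $\mathcal F(g_\xi)$ is a frame but not a Riesz basis. - If $\xi=-1/2+n$ for some integer $n\ge 0$, then $\mathcal F(g_\xi)$ is complete, but it is neither a frame nor a Riesz basis. -/

import Mathlib

open MeasureTheory

noncomputable section

namespace WindowedExp

section Hilbert

variable {ι H : Type*} [NormedAddCommGroup H] [InnerProductSpace ℂ H]

/-- A family of vectors is complete if only the zero vector is orthogonal to all its members. -/
def IsCompleteFamily (φ : ι → H) : Prop :=
  ∀ f : H, (∀ i, inner ℂ (φ i) f = 0) → f = 0

/-- A frame: `A ‖f‖² ≤ ∑ |⟨f, φ i⟩|² ≤ B ‖f‖²` for all `f`, with constants `0 < A ≤ B < ∞`. -/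
def IsFrame (φ : ι → H) : Prop :=
  ∃ A B : ℝ, 0 < A ∧ A ≤ B ∧ ∀ f : H,
    Summable (fun i => ‖inner ℂ (φ i) f‖ ^ 2) ∧
    A * ‖f‖ ^ 2 ≤ ∑' i, ‖inner ℂ (φ i) f‖ ^ 2 ∧
    ∑' i, ‖inner ℂ (φ i) f‖ ^ 2 ≤ B * ‖f‖ ^ 2

/-- A Riesz basis: a frame for which every vector has exactly one expansion
`f = ∑ α i • φ i`, the series converging unconditionally in norm. -/
def IsRieszBasis (φ : ι → H) : Prop :=
  IsFrame φ ∧ ∀ f : H, ∃! α : ι → ℂ, HasSum (fun i => α i • φ i) f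

end Hilbert

/-- Lebesgue measure on `[-1/2, 1/2]`. -/
abbrev μI : Measure ℝ := volume.restrict (Set.Icc (-1 / 2 : ℝ) (1 / 2))

/-- The Hilbert space `L²[-1/2, 1/2]` of complex-valued functions. -/
abbrev L2I : Type := Lp ℂ 2 μI

/-- The exponential `x ↦ e^{2πiξx}`. -/
def expFun (ξ : ℝ) (x : ℝ) : ℂ := Complex.exp (2 * Real.pi * Complex.I * ξ * x)

theorem continuous_expFun (ξ : ℝ) : Continuous (expFun ξ) := by
  unfold expFun; fun_prop

theorem norm_expFun (ξ x : ℝ) : ‖expFun ξ x‖ = 1 := by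
  have h : (2 * Real.pi * Complex.I * ξ * x : ℂ)
      = ((2 * Real.pi * ξ * x : ℝ) : ℂ) * Complex.I := by
    push_cast; ring
  rw [expFun, h, Complex.norm_exp_ofReal_mul_I]

theorem memLp_mul_expFun {g : ℝ → ℂ} (hg : MemLp g 2 μI) (t : ℝ) :
    MemLp (fun x => g x * expFun t x) 2 μI := by
  refine hg.of_le (hg.1.mul (continuous_expFun t).aestronglyMeasurable) ?_
  filter_upwards with x
  rw [norm_mul, norm_expFun, mul_one]

theorem memLp_expFun (ξ : ℝ) : MemLp (expFun ξ) 2 μI := by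
  refine MemLp.of_bound (continuous_expFun ξ).aestronglyMeasurable 1 ?_
  filter_upwards with x
  rw [norm_expFun]

theorem memLp_one : MemLp (fun _ : ℝ => (1 : ℂ)) 2 μI := memLp_const 1

/-- The windowed exponential `g(x) e^{2πitx}` as an element of `L²[-1/2, 1/2]`. -/
def windowedExp (g : ℝ → ℂ) (hg : MemLp g 2 μI) (t : ℝ) : L2I :=
  (memLp_mul_expFun hg t).toLp (fun x => g x * expFun t x)

/-- The system `𝓕(g) = {e^{2πinx} : n ≥ 0} ∪ {g(x) e^{2πinx} : n < 0}`, as a family indexed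
by `n ∈ ℤ` (so that functions occurring twice are counted twice). -/
def system (g : ℝ → ℂ) (hg : MemLp g 2 μI) (n : ℤ) : L2I :=
  if 0 ≤ n then windowedExp (fun _ => 1) memLp_one n else windowedExp g hg n

/-- The system `𝓕(g_ξ)` for the window `g_ξ(x) = e^{2πiξx}`. -/
def expSystem (ξ : ℝ) : ℤ → L2I := system (expFun ξ) (memLp_expFun ξ)

end WindowedExp

end

/-!
Let `P` be the orthogonal projection onto the closed span of the `e^{2πinx}` with `n ≥ 0`, and let
`M_ξ` be multiplication by `e^{2πiξx}`. The family `𝓕(g_ξ)` is the image of the Fourier basis under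
`T_ξ = P + M_ξ (1 - P)`, so it is complete, a frame or a Riesz basis according as `T_ξ` has dense
range, is surjective or is bijective.

* The factorisation `T_ξ = (P + (1 - P) M_ξ (1 - P)) (1 + P M_ξ (1 - P))` has a unipotent second
  factor. If `|ξ| < 1/2`, then the real part of `e^{2πiξx}` is at least `cos πξ > 0` on
  `[-1/2, 1/2]`, which makes the first factor coercive. If `|ξ| = 1/2`, this real part is still
  positive almost everywhere, and the range of `T_ξ` is dense.
* If `S_n` shifts the nonnegative frequencies up by `n`, then `T_{ξ + n} S_n = M_n T_ξ`. As the
  range of `S_n` has codimension `n`, passing from `ξ` to `ξ + n` preserves completeness and frames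
  but creates an excess of `n` vectors. Conversely, if `T_{ξ + n}` is surjective, then the range of
  `T_ξ` has finite codimension, hence is closed, so that it is everything once it is dense.
* For `ξ < -1`, the function `z^ξ (1 + z)^{-1 - ξ}` with `z = e^{2πix}` is orthogonal to the family.
  For `-1 ≤ ξ < -1/2`, completeness would make `𝓕(g_ξ)` a frame, since `𝓕(g_{ξ + 1})` is one, and
  then the Riesz basis `𝓕(g_{ξ + 1})` would have excess.
* Frames form an open set of parameters `ξ`, and no `ξ < -1/2` belongs to it, hence neither does
  `-1/2`.
-/

noncomputable section

namespace WindowedExp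

theorem add_mul_one_sub_eq_mul {R : Type*} [Ring R] {p : R} (hp : IsIdempotentElem p) (m : R) :
    p + m * (1 - p) = (p + (1 - p) * m * (1 - p)) * (1 + p * m * (1 - p)) :=
  calc p + m * (1 - p) = p + p * m * (1 - p) + (1 - p) * m * (1 - p) := by noncomm_ring
    _ = p + p * p * m * (1 - p) + (1 - p) * m * (1 - p)
          + (1 - p) * m * ((1 - p) * p) * m * (1 - p) := by
        rw [hp.eq, hp.one_sub_mul_self]
        noncomm_ring
    _ = (p + (1 - p) * m * (1 - p)) * (1 + p * m * (1 - p)) := by noncomm_ring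

section Banach

variable {𝕜 E F : Type*} [NontriviallyNormedField 𝕜] [CompleteSpace 𝕜]
  [NormedAddCommGroup E] [NormedSpace 𝕜 E] [CompleteSpace E]
  [NormedAddCommGroup F] [NormedSpace 𝕜 F] [CompleteSpace F]

open LinearMap.FiniteRangeSetoid in
theorem isClosed_range_of_range_sup_eq_top {T : E →L[𝕜] F} {W : Submodule 𝕜 F}
    [FiniteDimensional 𝕜 W] (hW : T.range ⊔ W = ⊤) : IsClosed (T.range : Set F) := by
  have : CompleteSpace W := FiniteDimensional.complete 𝕜 W
  set S : E × W →L[𝕜] F := T.coprod W.subtypeL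
  have hS_surj : Function.Surjective S := by
    rw [← ContinuousLinearMap.coe_coe, ← LinearMap.range_eq_top]
    simp [S, ContinuousLinearMap.coe_coprod, LinearMap.range_coprod, hW]
  have hS_equiv : S.toLinearMap ≈ (T ∘L .fst 𝕜 E W).toLinearMap := by
    rw [equiv_iff_hasFiniteRange]
    have hsub : S.toLinearMap - (T ∘L .fst 𝕜 E W).toLinearMap = W.subtype ∘ₗ .snd 𝕜 E W :=
      LinearMap.ext fun x => by simp [S]
    rw [hsub]
    exact (LinearMap.HasFiniteRange.of_finite_dom (f := W.subtype)).comp_right _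
  have hclosed := ((S.isStrictMap_isClosed_range_iff_of_finiteRangeSetoid _ hS_equiv).1
    ⟨(S.isOpenMap hS_surj).isStrictMap S.continuous,
      by rw [LinearMap.range_eq_top.2 hS_surj]; exact isClosed_univ⟩).2
  have hrange : (T ∘L .fst 𝕜 E W).range = T.range :=
    LinearMap.range_comp_of_range_eq_top _ (LinearMap.range_eq_top.2 Prod.fst_surjective)
  rwa [hrange] at hclosed

theorem surjective_of_denseRange_of_range_sup_eq_top {T : E →L[𝕜] F} {W : Submodule 𝕜 F}
    [FiniteDimensional 𝕜 W] (hT : DenseRange T) (hW : T.range ⊔ W = ⊤) :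
    Function.Surjective T := by
  rw [← Set.range_eq_univ, ← hT.closure_range]
  exact (isClosed_range_of_range_sup_eq_top hW).closure_eq.symm

end Banach

section Operators

open ContinuousLinearMap
open scoped InnerProductSpace

variable {𝕜 E F : Type*} [RCLike 𝕜] [NormedAddCommGroup E] [InnerProductSpace 𝕜 E]
  [CompleteSpace E] [NormedAddCommGroup F] [InnerProductSpace 𝕜 F] [CompleteSpace F]

theorem denseRange_iff_adjoint_injective {T : E →L[𝕜] F} :
    DenseRange T ↔ Function.Injective (adjoint T) := by
  rw [← ContinuousLinearMap.coe_coe (adjoint T), ← LinearMap.ker_eq_bot,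
    ← orthogonal_range, ← Submodule.topologicalClosure_eq_top_iff,
    ← Submodule.dense_iff_topologicalClosure_eq_top]
  rfl

theorem surjective_tfae (T : E →L[𝕜] F) : List.TFAE [
    Function.Surjective T,
    ∃ c > 0, ∀ f, c * ‖f‖ ≤ ‖adjoint T f‖,
    IsUnit (T ∘L adjoint T)] := by
  tfae_have 1 → 2 := fun hT => by
    obtain ⟨C, hC, hpre⟩ := T.exists_preimage_norm_le hT
    refine ⟨C⁻¹, inv_pos.2 hC, fun f => ?_⟩
    obtain ⟨g, rfl, hg⟩ := hpre f
    rw [inv_mul_le_iff₀ hC]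
    rcases (norm_nonneg (T g)).eq_or_lt with h0 | hpos
    · rw [← h0]; positivity
    refine le_of_mul_le_mul_left ?_ hpos
    calc ‖T g‖ * ‖T g‖ = RCLike.re ⟪g, adjoint T (T g)⟫_𝕜 := by
          rw [adjoint_inner_right, inner_self_eq_norm_mul_norm]
      _ ≤ ‖g‖ * ‖adjoint T (T g)‖ := re_inner_le_norm _ _
      _ ≤ C * ‖T g‖ * ‖adjoint T (T g)‖ := by gcongr
      _ = ‖T g‖ * (C * ‖adjoint T (T g)‖) := by ring
  tfae_have 2 → 3 := fun ⟨c, hc, hT⟩ => by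
    refine isUnit_of_forall_le_norm_inner_map _ (c := ⟨c ^ 2, by positivity⟩)
      (show 0 < c ^ 2 by positivity) fun f => ?_
    calc ‖f‖ ^ 2 * c ^ 2 = (c * ‖f‖) ^ 2 := by ring
      _ ≤ ‖adjoint T f‖ ^ 2 := by gcongr; exact hT f
      _ = RCLike.re ⟪(T ∘L adjoint T) f, f⟫_𝕜 := by
          rw [comp_apply, ← adjoint_inner_right, inner_self_eq_norm_sq]
      _ ≤ ‖⟪(T ∘L adjoint T) f, f⟫_𝕜‖ := RCLike.re_le_norm _
  tfae_have 3 → 1 := fun hT =>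
    .of_comp (g := adjoint T) (isUnit_iff_bijective.1 hT).surjective
  tfae_finish

variable {P M : E →L[𝕜] E}

theorem inner_apply_self_of_isStarProjection (hP : IsStarProjection P) (f : E) :
    ⟪P f, f⟫_𝕜 = ⟪P f, P f⟫_𝕜 := by
  conv_lhs => rw [← hP.isIdempotentElem.eq, mul_apply_eq_comp]
  rw [← adjoint_inner_right, hP.isSelfAdjoint.adjoint_eq]

theorem norm_sq_eq_add_norm_sq_of_isStarProjection (hP : IsStarProjection P) (f : E) :
    ‖f‖ ^ 2 = ‖P f‖ ^ 2 + ‖(1 - P) f‖ ^ 2 := by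
  obtain ⟨K, _, rfl⟩ := isStarProjection_iff_eq_starProjection.1 hP
  rw [K.norm_sq_eq_add_norm_sq_starProjection f, Submodule.starProjection_orthogonal]
  rfl

theorem re_inner_add_compression (hP : IsStarProjection P) (f : E) :
    RCLike.re ⟪(P + (1 - P) * M * (1 - P)) f, f⟫_𝕜
      = ‖P f‖ ^ 2 + RCLike.re ⟪M ((1 - P) f), (1 - P) f⟫_𝕜 := by
  rw [add_apply, mul_apply_eq_comp, mul_apply_eq_comp, inner_add_left,
    inner_apply_self_of_isStarProjection hP, map_add, inner_self_eq_norm_sq, ← adjoint_inner_right,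
    hP.one_sub.isSelfAdjoint.adjoint_eq]

theorem isUnit_add_compression_of_le_re_inner (hP : IsStarProjection P) {c : ℝ} (hc : 0 < c)
    (hM : ∀ f, c * ‖f‖ ^ 2 ≤ RCLike.re ⟪M f, f⟫_𝕜) : IsUnit (P + (1 - P) * M * (1 - P)) := by
  refine isUnit_of_forall_le_norm_inner_map _ (c := ⟨min 1 c, by positivity⟩)
    (show 0 < min 1 c by positivity) fun f => ?_
  calc ‖f‖ ^ 2 * min 1 c = min 1 c * ‖P f‖ ^ 2 + min 1 c * ‖(1 - P) f‖ ^ 2 := by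
        rw [norm_sq_eq_add_norm_sq_of_isStarProjection hP f]; ring
    _ ≤ 1 * ‖P f‖ ^ 2 + c * ‖(1 - P) f‖ ^ 2 := by
        gcongr
        exacts [min_le_left _ _, min_le_right _ _]
    _ ≤ ‖P f‖ ^ 2 + RCLike.re ⟪M ((1 - P) f), (1 - P) f⟫_𝕜 := by
        rw [one_mul]; gcongr; exact hM _
    _ = RCLike.re ⟪(P + (1 - P) * M * (1 - P)) f, f⟫_𝕜 := (re_inner_add_compression hP f).symm
    _ ≤ ‖⟪(P + (1 - P) * M * (1 - P)) f, f⟫_𝕜‖ := RCLike.re_le_norm _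

theorem isUnit_add_mul_one_sub_of_le_re_inner (hP : IsStarProjection P) {c : ℝ} (hc : 0 < c)
    (hM : ∀ f, c * ‖f‖ ^ 2 ≤ RCLike.re ⟪M f, f⟫_𝕜) : IsUnit (P + M * (1 - P)) := by
  have hunipotent : IsUnit (1 + P * M * (1 - P)) := by
    refine IsNilpotent.isUnit_one_add ⟨2, ?_⟩
    calc (P * M * (1 - P)) ^ 2 = P * M * ((1 - P) * P) * M * (1 - P) := by noncomm_ring
      _ = 0 := by rw [hP.isIdempotentElem.one_sub_mul_self, mul_zero, zero_mul, zero_mul]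
  rw [add_mul_one_sub_eq_mul hP.isIdempotentElem]
  exact (isUnit_add_compression_of_le_re_inner hP hc hM).mul hunipotent

theorem denseRange_add_mul_one_sub (hP : IsStarProjection P)
    (hM : ∀ f, ⟪M f, f⟫_𝕜 = 0 → f = 0) : DenseRange ⇑(P + M * (1 - P)) := by
  rw [denseRange_iff_adjoint_injective, injective_iff_map_eq_zero]
  intro f hf
  have horth : ∀ g, ⟪(P + M * (1 - P)) g, f⟫_𝕜 = 0 := fun g => by
    rw [← adjoint_inner_right, hf, inner_zero_right]
  have hPf : P f = 0 := by
    have hTP : (P + M * (1 - P)) (P f) = P f := by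
      rw [← mul_apply_eq_comp, add_mul, mul_assoc, hP.isIdempotentElem.one_sub_mul_self,
        hP.isIdempotentElem.eq, mul_zero, add_zero]
    rw [← inner_self_eq_zero (𝕜 := 𝕜), ← inner_apply_self_of_isStarProjection hP, ← hTP]
    exact horth _
  have hTf := horth f
  rw [add_apply, mul_apply_eq_comp, sub_apply, hPf, zero_add, sub_zero] at hTf
  exact hM f hTf

end Operators

section HilbertBasis

open ContinuousLinearMap
open scoped InnerProductSpace

variable {ι 𝕜 E F : Type*} [RCLike 𝕜] [NormedAddCommGroup E] [InnerProductSpace 𝕜 E]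
  [NormedAddCommGroup F] [NormedSpace 𝕜 F]

theorem orthonormal_of_hasSum_norm_inner_sq {v : ι → E} (hnorm : ∀ i, ‖v i‖ = 1)
    (hv : ∀ f, HasSum (fun i => ‖⟪v i, f⟫_𝕜‖ ^ 2) (‖f‖ ^ 2)) : Orthonormal 𝕜 v := by
  classical
  refine ⟨hnorm, fun i j hij => ?_⟩
  have hle := sum_le_hasSum {i, j} (fun _ _ => sq_nonneg _) (hv (v j))
  rw [Finset.sum_pair hij, inner_self_eq_norm_sq_to_K, hnorm] at hle
  have hzero : ‖⟪v i, v j⟫_𝕜‖ ^ 2 ≤ 0 := by simpa using hle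
  simpa using hzero.antisymm (sq_nonneg _)

theorem orthogonal_span_range_eq_bot_of_hasSum_norm_inner_sq {v : ι → E}
    (hv : ∀ f, HasSum (fun i => ‖⟪v i, f⟫_𝕜‖ ^ 2) (‖f‖ ^ 2)) :
    (Submodule.span 𝕜 (Set.range v))ᗮ = ⊥ := by
  refine (Submodule.eq_bot_iff _).2 fun f hf => ?_
  have horth : ∀ i, ⟪v i, f⟫_𝕜 = 0 := fun i =>
    Submodule.inner_right_of_mem_orthogonal (Submodule.subset_span (Set.mem_range_self i)) hf
  have hsum := hv f
  simp only [horth, norm_zero, ne_eq, OfNat.ofNat_ne_zero, not_false_eq_true, zero_pow] at hsum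
  simpa using hsum.unique hasSum_zero

theorem hasSum_norm_inner_sq (b : HilbertBasis ι 𝕜 E) (f : E) :
    HasSum (fun i => ‖⟪b i, f⟫_𝕜‖ ^ 2) (‖f‖ ^ 2) := by
  simpa [HilbertBasis.repr_apply_apply] using
    lp.hasSum_norm (p := 2) (by norm_num) (b.repr f)

theorem eq_repr_of_hasSum (b : HilbertBasis ι 𝕜 E) {α : ι → 𝕜} {f : E}
    (hα : HasSum (fun i => α i • b i) f) : α = b.repr f := by
  funext i
  have hinner := hα.mapL (innerSL 𝕜 (b i))
  simp only [innerSL_apply_apply, inner_smul_right] at hinner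
  have hsingle := hasSum_single (f := fun j => α j * ⟪b i, b j⟫_𝕜) i fun j hj => by
    rw [b.orthonormal.2 hj.symm, mul_zero]
  rw [b.repr_apply_apply, ← hsingle.unique hinner, inner_self_eq_norm_sq_to_K,
    b.orthonormal.1]
  simp

theorem ext_of_hilbertBasis (b : HilbertBasis ι 𝕜 E) {S T : E →L[𝕜] F}
    (h : ∀ i, S (b i) = T (b i)) : S = T :=
  ContinuousLinearMap.ext_on
    (Submodule.dense_iff_topologicalClosure_eq_top.2 b.dense_span) (Set.forall_mem_range.2 h)

theorem range_le_of_forall_hilbertBasis_mem (b : HilbertBasis ι 𝕜 E) {T : E →L[𝕜] F}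
    {W : Submodule 𝕜 F} (hW : IsClosed (W : Set F)) (h : ∀ i, T (b i) ∈ W) : T.range ≤ W := by
  rintro _ ⟨f, rfl⟩
  refine hW.mem_of_tendsto ((b.hasSum_repr f).mapL T) (.of_forall fun s => ?_)
  simp only [map_smul]
  exact W.sum_mem fun i _ => W.smul_mem _ (h i)

variable [CompleteSpace E]

/-- The orthogonal projection onto the closed span of the basis vectors `b i` with `i ∈ s`. -/
def coordProj (b : HilbertBasis ι 𝕜 E) (s : Set ι) : E →L[𝕜] E :=
  (Submodule.span 𝕜 (b '' s)).topologicalClosure.starProjection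

variable (b : HilbertBasis ι 𝕜 E) {s : Set ι} {i : ι}

theorem isStarProjection_coordProj (s : Set ι) : IsStarProjection (coordProj b s) :=
  isStarProjection_starProjection

theorem coordProj_apply_of_mem (hi : i ∈ s) : coordProj b s (b i) = b i :=
  Submodule.starProjection_eq_self_iff.2 <|
    Submodule.le_topologicalClosure _ (Submodule.subset_span ⟨i, hi, rfl⟩)

theorem coordProj_apply_of_notMem (hi : i ∉ s) : coordProj b s (b i) = 0 := by
  rw [coordProj, Submodule.starProjection_apply_eq_zero_iff, Submodule.orthogonal_closure,
    ← Submodule.span_singleton_le_iff_mem]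
  refine Submodule.isOrtho_span.2 ?_
  rintro _ rfl _ ⟨j, hj, rfl⟩
  exact b.orthonormal.2 fun hij => hi (hij ▸ hj)

theorem coordProj_add_mul_apply (s : Set ι) (M : E →L[𝕜] E) (i : ι) [Decidable (i ∈ s)] :
    (coordProj b s + M * (1 - coordProj b s)) (b i) = if i ∈ s then b i else M (b i) := by
  split_ifs with hi
  · simp [coordProj_apply_of_mem b hi]
  · simp [coordProj_apply_of_notMem b hi]

end HilbertBasis

section Families

open ContinuousLinearMap

variable {ι H K : Type*} [NormedAddCommGroup H] [InnerProductSpace ℂ H] [CompleteSpace H]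
  [NormedAddCommGroup K] [InnerProductSpace ℂ K] [CompleteSpace K]
  (b : HilbertBasis ι ℂ H) (T : H →L[ℂ] K)

theorem hasSum_norm_inner_apply_sq (f : K) :
    HasSum (fun i => ‖inner ℂ (T (b i)) f‖ ^ 2) (‖T.adjoint f‖ ^ 2) := by
  simp only [← ContinuousLinearMap.adjoint_inner_right]
  exact hasSum_norm_inner_sq b (T.adjoint f)

theorem isCompleteFamily_iff_denseRange :
    IsCompleteFamily (fun i => T (b i)) ↔ DenseRange T := by
  rw [denseRange_iff_adjoint_injective, injective_iff_map_eq_zero]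
  refine forall_congr' fun f => imp_congr_left ?_
  have hsum := hasSum_norm_inner_apply_sq b T f
  refine ⟨fun h => ?_, fun h i => ?_⟩
  · simp only [h, norm_zero, ne_eq, OfNat.ofNat_ne_zero, not_false_eq_true, zero_pow] at hsum
    simpa using hsum.unique hasSum_zero
  · rw [← adjoint_inner_right, h, inner_zero_right]

theorem isFrame_iff_surjective : IsFrame (fun i => T (b i)) ↔ Function.Surjective T := by
  refine Iff.trans ?_ ((surjective_tfae T).out 0 1).symm
  simp only [IsFrame, (hasSum_norm_inner_apply_sq b T _).tsum_eq,
    (hasSum_norm_inner_apply_sq b T _).summable, true_and]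
  constructor
  · rintro ⟨A, B, hA, -, hAB⟩
    refine ⟨√A, Real.sqrt_pos.2 hA, fun f => ?_⟩
    refine le_of_sq_le_sq ?_ (norm_nonneg _)
    rw [mul_pow, Real.sq_sqrt hA.le]
    exact (hAB f).1
  · rintro ⟨c, hc, hT⟩
    refine ⟨c ^ 2, max (c ^ 2) (‖T.adjoint‖ ^ 2), by positivity, le_max_left _ _, fun f => ?_⟩
    simp only [← mul_pow]
    refine ⟨by gcongr; exact hT f, ?_⟩
    calc ‖T.adjoint f‖ ^ 2 ≤ (‖T.adjoint‖ * ‖f‖) ^ 2 := by gcongr; exact T.adjoint.le_opNorm f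
      _ ≤ max (c ^ 2) (‖T.adjoint‖ ^ 2) * ‖f‖ ^ 2 := by
          rw [mul_pow]; gcongr; exact le_max_right _ _

theorem isRieszBasis_iff_bijective : IsRieszBasis (fun i => T (b i)) ↔ Function.Bijective T := by
  have hsum : ∀ f, HasSum (fun i => b.repr f i • T (b i)) (T f) := fun f => by
    simpa using (b.hasSum_repr f).mapL T
  rw [IsRieszBasis, isFrame_iff_surjective, and_comm, Function.Bijective]
  refine and_congr_left fun hsurj => ⟨fun hexp => ?_, fun hinj f => ?_⟩
  · refine (injective_iff_map_eq_zero T).2 fun f hf => ?_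
    have hrepr : (b.repr f : ι → ℂ) = (0 : ι → ℂ) :=
      (hexp 0).unique (hf ▸ hsum f) (by simp)
    exact b.repr.map_eq_zero_iff.1 (lp.ext hrepr)
  · let e : H ≃L[ℂ] K := ContinuousLinearEquiv.ofBijective T
      (LinearMap.ker_eq_bot.2 hinj) (LinearMap.range_eq_top.2 hsurj)
    obtain ⟨g, rfl⟩ := hsurj f
    refine ⟨b.repr g, hsum g, fun α hα => eq_repr_of_hasSum b ?_⟩
    have hg := hα.mapL (e.symm : K →L[ℂ] H)
    simp only [map_smul, ContinuousLinearEquiv.coe_coe] at hg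
    have hsymm : ∀ x, e.symm (T x) = x := e.symm_apply_apply
    simpa only [hsymm] using hg

end Families

section Modulation

theorem expFun_add (s t x : ℝ) : expFun (s + t) x = expFun s x * expFun t x := by
  rw [expFun, expFun, expFun, ← Complex.exp_add]
  push_cast
  ring_nf

theorem expFun_zero (x : ℝ) : expFun 0 x = 1 := by simp [expFun]

theorem conj_expFun (t x : ℝ) : starRingEnd ℂ (expFun t x) = expFun (-t) x := by
  rw [expFun, expFun, ← Complex.exp_conj]
  simp [Complex.conj_ofNat]

theorem expFun_eq_exp_I_mul (t x : ℝ) :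
    expFun t x = Complex.exp (Complex.I * ((2 * Real.pi * t * x : ℝ) : ℂ)) := by
  rw [expFun]
  push_cast
  ring_nf

theorem re_expFun (t x : ℝ) : (expFun t x).re = Real.cos (2 * Real.pi * t * x) := by
  rw [expFun_eq_exp_I_mul, mul_comm, Complex.exp_ofReal_mul_I_re]

theorem norm_expFun_sub_le (s t x : ℝ) :
    ‖expFun s x - expFun t x‖ ≤ 2 * Real.pi * |s - t| * |x| := by
  have hfactor : expFun s x = expFun t x * expFun (s - t) x := by
    rw [← expFun_add, add_sub_cancel]
  rw [hfactor, ← mul_sub_one, norm_mul, norm_expFun, one_mul, expFun_eq_exp_I_mul]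
  refine Real.norm_exp_I_mul_ofReal_sub_one_le.trans_eq ?_
  rw [Real.norm_eq_abs, abs_mul, abs_mul, abs_of_pos Real.two_pi_pos]

theorem coeFn_windowedExp (g : ℝ → ℂ) (hg : MemLp g 2 μI) (t : ℝ) :
    windowedExp g hg t =ᵐ[μI] fun x => g x * expFun t x :=
  MemLp.coeFn_toLp (memLp_mul_expFun hg t)

theorem norm_windowedExp (f : L2I) (t : ℝ) : ‖windowedExp f (Lp.memLp f) t‖ = ‖f‖ := by
  rw [windowedExp, Lp.norm_toLp, Lp.norm_def]
  congr 1
  refine eLpNorm_congr_norm_ae (.of_forall fun x => ?_)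
  rw [norm_mul, norm_expFun, mul_one]

/-- Multiplication by `e^{2πitx}` as a bounded operator on `L²[-1/2, 1/2]`. -/
def modulation (t : ℝ) : L2I →L[ℂ] L2I :=
  LinearIsometry.toContinuousLinearMap
    { toFun f := windowedExp f (Lp.memLp f) t
      map_add' f g := by
        refine Lp.ext ?_
        filter_upwards [coeFn_windowedExp _ (Lp.memLp (f + g)) t,
          coeFn_windowedExp _ (Lp.memLp f) t, coeFn_windowedExp _ (Lp.memLp g) t,
          Lp.coeFn_add (windowedExp f (Lp.memLp f) t) (windowedExp g (Lp.memLp g) t),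
          Lp.coeFn_add f g] with x hfg hf hg hadd hfg_add
        rw [hadd, Pi.add_apply, hfg, hf, hg, hfg_add, Pi.add_apply, add_mul]
      map_smul' c f := by
        refine Lp.ext ?_
        filter_upwards [coeFn_windowedExp _ (Lp.memLp (c • f)) t,
          coeFn_windowedExp _ (Lp.memLp f) t, Lp.coeFn_smul c (windowedExp f (Lp.memLp f) t),
          Lp.coeFn_smul c f] with x hcf hf hsmul hcf_smul
        rw [RingHom.id_apply, hsmul, Pi.smul_apply, hcf, hf, hcf_smul, Pi.smul_apply,
          smul_mul_assoc]
      norm_map' f := norm_windowedExp f t }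

theorem coeFn_modulation (t : ℝ) (f : L2I) :
    modulation t f =ᵐ[μI] fun x => f x * expFun t x :=
  coeFn_windowedExp f (Lp.memLp f) t

theorem modulation_apply_windowedExp {g : ℝ → ℂ} (hg : MemLp g 2 μI) (s t : ℝ) :
    modulation s (windowedExp g hg t) = windowedExp g hg (s + t) := by
  refine Lp.ext ?_
  filter_upwards [coeFn_modulation s (windowedExp g hg t), coeFn_windowedExp g hg t,
    coeFn_windowedExp g hg (s + t)] with x hmod ht hst
  rw [hmod, ht, hst, mul_assoc, add_comm s, expFun_add]

theorem modulation_add (s t : ℝ) : modulation (s + t) = modulation s * modulation t := by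
  ext1 f
  exact (modulation_apply_windowedExp (Lp.memLp f) s t).symm

theorem modulation_zero : modulation 0 = 1 := by
  refine ContinuousLinearMap.ext fun f => Lp.ext ?_
  filter_upwards [coeFn_modulation 0 f] with x hx
  rw [hx, expFun_zero, mul_one, one_apply_eq_self]

theorem modulation_mul_modulation_neg (t : ℝ) : modulation t * modulation (-t) = 1 := by
  rw [← modulation_add, add_neg_cancel, modulation_zero]

theorem bijective_modulation (t : ℝ) : Function.Bijective (modulation t) :=
  ContinuousLinearMap.isUnit_iff_bijective.1 <| isUnit_iff_exists.2
    ⟨modulation (-t), modulation_mul_modulation_neg t,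
      by simpa using modulation_mul_modulation_neg (-t)⟩

theorem norm_modulation_sub_le (s t : ℝ) :
    ‖modulation s - modulation t‖ ≤ Real.pi * |s - t| := by
  refine ContinuousLinearMap.opNorm_le_bound _ (by positivity) fun f =>
    Lp.norm_le_mul_norm_of_ae_le_mul ?_
  filter_upwards [coeFn_modulation s f, coeFn_modulation t f,
    Lp.coeFn_sub (modulation s f) (modulation t f), ae_restrict_mem measurableSet_Icc]
    with x hs ht hsub hx
  have hx_abs : |x| ≤ 1 / 2 := abs_le.2 ⟨by linarith [hx.1], hx.2⟩
  rw [sub_apply, hsub, Pi.sub_apply, hs, ht, ← mul_sub, norm_mul, mul_comm]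
  gcongr
  calc ‖expFun s x - expFun t x‖ ≤ 2 * Real.pi * |s - t| * |x| := norm_expFun_sub_le s t x
    _ ≤ 2 * Real.pi * |s - t| * (1 / 2) := by gcongr
    _ = Real.pi * |s - t| := by ring

theorem continuous_modulation : Continuous modulation :=
  (LipschitzWith.of_dist_le_mul (K := ⟨Real.pi, Real.pi_pos.le⟩) fun s t => by
    rw [dist_eq_norm, Real.dist_eq]
    exact norm_modulation_sub_le s t).continuous

theorem re_inner_modulation (t : ℝ) (f : L2I) :
    (inner ℂ (modulation t f) f).re
      = ∫ x, Real.cos (2 * Real.pi * t * x) * ‖f x‖ ^ 2 ∂μI := by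
  rw [L2.inner_def, ← Complex.reCLM_apply,
    ← ContinuousLinearMap.integral_comp_comm _ (L2.integrable_inner (modulation t f) f)]
  refine integral_congr_ae ?_
  filter_upwards [coeFn_modulation t f] with x hx
  rw [Complex.reCLM_apply, hx, RCLike.inner_apply, map_mul, ← mul_assoc, Complex.mul_conj,
    Complex.normSq_eq_norm_sq, Complex.re_ofReal_mul, Complex.conj_re, re_expFun, mul_comm]

theorem integrable_norm_sq (f : L2I) : Integrable (fun x => ‖f x‖ ^ 2) μI :=
  (Lp.memLp f).integrable_norm_pow (by norm_num)

theorem integrable_cos_mul_norm_sq (t : ℝ) (f : L2I) :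
    Integrable (fun x => Real.cos (2 * Real.pi * t * x) * ‖f x‖ ^ 2) μI :=
  (integrable_norm_sq f).bdd_mul (c := 1) (Continuous.aestronglyMeasurable (by fun_prop))
    (.of_forall fun _ => Real.abs_cos_le_one _)

theorem norm_sq_eq_integral (f : L2I) : ‖f‖ ^ 2 = ∫ x, ‖f x‖ ^ 2 ∂μI := by
  have h := re_inner_modulation 0 f
  rw [modulation_zero, one_apply_eq_self, inner_self_eq_norm_sq_to_K] at h
  simp only [mul_zero, zero_mul, Real.cos_zero, one_mul] at h
  rw [← h]
  norm_cast

theorem cos_pi_mul_pos {t : ℝ} (ht : |t| < 1 / 2) : 0 < Real.cos (Real.pi * t) := by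
  obtain ⟨hlower, hupper⟩ := abs_lt.1 ht
  exact Real.cos_pos_of_mem_Ioo ⟨by nlinarith [Real.pi_pos], by nlinarith [Real.pi_pos]⟩

theorem cos_mul_norm_sq_le_re_inner_modulation {t : ℝ} (ht : |t| ≤ 1 / 2) (f : L2I) :
    Real.cos (Real.pi * t) * ‖f‖ ^ 2 ≤ (inner ℂ (modulation t f) f).re := by
  rw [re_inner_modulation, norm_sq_eq_integral, ← integral_const_mul]
  refine integral_mono_ae ((integrable_norm_sq f).const_mul _) (integrable_cos_mul_norm_sq t f) ?_
  filter_upwards [ae_restrict_mem measurableSet_Icc] with x hx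
  have hx_abs : |2 * x| ≤ 1 := abs_le.2 ⟨by linarith [hx.1], by linarith [hx.2]⟩
  gcongr
  rw [← Real.cos_abs (Real.pi * t), ← Real.cos_abs (2 * Real.pi * t * x)]
  refine Real.cos_le_cos_of_nonneg_of_le_pi (abs_nonneg _) ?_ ?_
  · rw [abs_mul, abs_of_pos Real.pi_pos]
    nlinarith [Real.pi_pos]
  · calc |2 * Real.pi * t * x| = |Real.pi * t| * |2 * x| := by rw [← abs_mul]; ring_nf
      _ ≤ |Real.pi * t| := mul_le_of_le_one_right (abs_nonneg _) hx_abs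

theorem eq_zero_of_inner_modulation_eq_zero {t : ℝ} (ht : |t| ≤ 1 / 2) {f : L2I}
    (h : inner ℂ (modulation t f) f = 0) : f = 0 := by
  have hcos : ∀ᵐ x ∂μI, 0 < Real.cos (2 * Real.pi * t * x) := by
    rw [μI, ← restrict_Ioo_eq_restrict_Icc]
    filter_upwards [ae_restrict_mem measurableSet_Ioo] with x hx
    have hx_abs : |2 * x| < 1 := abs_lt.2 ⟨by linarith [hx.1], by linarith [hx.2]⟩
    have htx : |2 * t * x| < 1 / 2 :=
      calc |2 * t * x| = |t| * |2 * x| := by rw [← abs_mul]; ring_nf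
        _ ≤ 1 / 2 * |2 * x| := by gcongr
        _ < 1 / 2 := by linarith
    simpa only [mul_left_comm Real.pi, mul_assoc] using cos_pi_mul_pos htx
  have hint : ∫ x, Real.cos (2 * Real.pi * t * x) * ‖f x‖ ^ 2 ∂μI = 0 := by
    rw [← re_inner_modulation, h, Complex.zero_re]
  rw [integral_eq_zero_iff_of_nonneg_ae (hcos.mono fun x hx => by positivity)
    (integrable_cos_mul_norm_sq t f)] at hint
  refine Lp.ext ?_
  filter_upwards [hint, hcos, Lp.coeFn_zero ℂ 2 μI] with x hx hpos hzero
  rw [hzero]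
  simpa [hpos.ne'] using hx

end Modulation

section FourierBasis

/-- The exponential `e^{2πitx}` as an element of `L²[-1/2, 1/2]`. -/
def expVec (t : ℝ) : L2I := windowedExp (fun _ => 1) memLp_one t

theorem coeFn_expVec (t : ℝ) : expVec t =ᵐ[μI] expFun t := by
  simpa only [expVec, one_mul] using coeFn_windowedExp _ memLp_one t

theorem modulation_apply_expVec (s t : ℝ) : modulation s (expVec t) = expVec (s + t) :=
  modulation_apply_windowedExp memLp_one s t

theorem windowedExp_expFun (s t : ℝ) :
    windowedExp (expFun s) (memLp_expFun s) t = expVec (s + t) := by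
  refine Lp.ext ?_
  filter_upwards [coeFn_windowedExp _ (memLp_expFun s) t, coeFn_expVec (s + t)] with x hs hst
  rw [hs, hst, expFun_add]

theorem expSystem_apply (ξ : ℝ) (n : ℤ) :
    expSystem ξ n = if 0 ≤ n then expVec n else expVec (ξ + n) := by
  simp only [expSystem, system, windowedExp_expFun, expVec]

theorem inner_expVec (t : ℝ) (f : L2I) :
    inner ℂ (expVec t) f = ∫ x in (-1 / 2 : ℝ)..(1 / 2), expFun (-t) x * f x := by
  rw [intervalIntegral.integral_of_le (by norm_num), ← integral_Icc_eq_integral_Ioc, L2.inner_def]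
  refine integral_congr_ae ?_
  filter_upwards [coeFn_expVec t] with x hx
  rw [hx, RCLike.inner_apply, conj_expFun, mul_comm]

theorem inner_expVec_intCast (n : ℤ) (f : L2I) :
    inner ℂ (expVec n) f = fourierCoeffOn (by norm_num : (-1 / 2 : ℝ) < 1 / 2) f n := by
  have hfourier : ∀ x : ℝ, fourier (-n) (x : AddCircle (1 / 2 - -1 / 2 : ℝ)) = expFun (-n) x :=
    fun x => by
      rw [fourier_coe_apply, expFun]
      norm_num
  simp only [fourierCoeffOn_eq_integral, inner_expVec, hfourier, smul_eq_mul]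
  norm_num

theorem hasSum_norm_inner_expVec_sq (f : L2I) :
    HasSum (fun n : ℤ => ‖inner ℂ (expVec n) f‖ ^ 2) (‖f‖ ^ 2) := by
  simp only [inner_expVec_intCast]
  have hf : MemLp f 2 (volume.restrict (Set.Ioc (-1 / 2 : ℝ) (1 / 2))) := by
    rw [restrict_Ioc_eq_restrict_Icc]
    exact Lp.memLp f
  convert hasSum_sq_fourierCoeffOn (by norm_num : (-1 / 2 : ℝ) < 1 / 2) hf using 1
  rw [intervalIntegral.integral_of_le (by norm_num), ← integral_Icc_eq_integral_Ioc,
    norm_sq_eq_integral, show (1 / 2 - -1 / 2 : ℝ) = 1 by norm_num, inv_one, one_smul]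

theorem norm_expVec (t : ℝ) : ‖expVec t‖ = 1 := by
  refine (pow_eq_one_iff_of_nonneg (norm_nonneg _) two_ne_zero).1 ?_
  calc ‖expVec t‖ ^ 2 = ∫ x, ‖expVec t x‖ ^ 2 ∂μI := norm_sq_eq_integral _
    _ = ∫ _, (1 : ℝ) ∂μI := by
      refine integral_congr_ae ?_
      filter_upwards [coeFn_expVec t] with x hx
      rw [hx, norm_expFun, one_pow]
    _ = 1 := by norm_num [Measure.real]

/-- The Fourier basis `(e^{2πinx})_{n ∈ ℤ}` of `L²[-1/2, 1/2]`. -/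
def expBasis : HilbertBasis ℤ ℂ L2I :=
  .mkOfOrthogonalEqBot
    (orthonormal_of_hasSum_norm_inner_sq (fun n : ℤ => norm_expVec n) hasSum_norm_inner_expVec_sq)
    (orthogonal_span_range_eq_bot_of_hasSum_norm_inner_sq hasSum_norm_inner_expVec_sq)

theorem expBasis_apply (n : ℤ) : expBasis n = expVec n :=
  congrFun (HilbertBasis.coe_mkOfOrthogonalEqBot _ _) n

theorem modulation_apply_expBasis (m n : ℤ) :
    modulation m (expBasis n) = expBasis (m + n) := by
  rw [expBasis_apply, expBasis_apply, modulation_apply_expVec, Int.cast_add]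

end FourierBasis

section Synthesis

/-- The orthogonal projection of `L²[-1/2, 1/2]` onto the Hardy space, the closed span of the
exponentials `e^{2πinx}` with `n ≥ 0`. -/
def hardyProj : L2I →L[ℂ] L2I := coordProj expBasis {n | 0 ≤ n}

/-- The synthesis operator of `expSystem ξ`: it maps the Fourier basis to this family. -/
def synthesis (ξ : ℝ) : L2I →L[ℂ] L2I := hardyProj + modulation ξ * (1 - hardyProj)

theorem hardyProj_apply_expBasis (n : ℤ) :
    hardyProj (expBasis n) = if 0 ≤ n then expBasis n else 0 := by
  split_ifs with hn
  · exact coordProj_apply_of_mem expBasis hn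
  · exact coordProj_apply_of_notMem expBasis hn

theorem isStarProjection_hardyProj : IsStarProjection hardyProj :=
  isStarProjection_coordProj expBasis _

theorem synthesis_apply_expBasis (ξ : ℝ) (n : ℤ) : synthesis ξ (expBasis n) = expSystem ξ n := by
  rw [synthesis, hardyProj, coordProj_add_mul_apply, expSystem_apply]
  simp only [expBasis_apply, modulation_apply_expVec, Set.mem_ofPred_eq]

theorem expSystem_eq_synthesis (ξ : ℝ) : expSystem ξ = fun n => synthesis ξ (expBasis n) :=
  funext fun n => (synthesis_apply_expBasis ξ n).symm

theorem isCompleteFamily_expSystem_iff {ξ : ℝ} :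
    IsCompleteFamily (expSystem ξ) ↔ DenseRange (synthesis ξ) := by
  rw [expSystem_eq_synthesis, isCompleteFamily_iff_denseRange]

theorem isFrame_expSystem_iff {ξ : ℝ} :
    IsFrame (expSystem ξ) ↔ Function.Surjective (synthesis ξ) := by
  rw [expSystem_eq_synthesis, isFrame_iff_surjective]

theorem isRieszBasis_expSystem_iff {ξ : ℝ} :
    IsRieszBasis (expSystem ξ) ↔ Function.Bijective (synthesis ξ) := by
  rw [expSystem_eq_synthesis, isRieszBasis_iff_bijective]

theorem isCompleteFamily_expSystem_of_isFrame {ξ : ℝ} (h : IsFrame (expSystem ξ)) :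
    IsCompleteFamily (expSystem ξ) :=
  isCompleteFamily_expSystem_iff.2 (isFrame_expSystem_iff.1 h).denseRange

theorem isRieszBasis_expSystem_of_abs_lt {ξ : ℝ} (hξ : |ξ| < 1 / 2) :
    IsRieszBasis (expSystem ξ) :=
  isRieszBasis_expSystem_iff.2 <| ContinuousLinearMap.isUnit_iff_bijective.1 <|
    isUnit_add_mul_one_sub_of_le_re_inner isStarProjection_hardyProj (cos_pi_mul_pos hξ)
      (cos_mul_norm_sq_le_re_inner_modulation hξ.le)

theorem isCompleteFamily_expSystem_of_abs_le {ξ : ℝ} (hξ : |ξ| ≤ 1 / 2) :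
    IsCompleteFamily (expSystem ξ) :=
  isCompleteFamily_expSystem_iff.2 <| denseRange_add_mul_one_sub isStarProjection_hardyProj
    fun _ => eq_zero_of_inner_modulation_eq_zero hξ

theorem continuous_synthesis : Continuous synthesis :=
  continuous_const.add (continuous_modulation.mul continuous_const)

theorem isOpen_setOf_isFrame_expSystem : IsOpen {ξ : ℝ | IsFrame (expSystem ξ)} := by
  have hset : {ξ : ℝ | IsFrame (expSystem ξ)}
      = (fun ξ => synthesis ξ * (synthesis ξ).adjoint) ⁻¹' {T | IsUnit T} := by
    ext ξ
    exact isFrame_expSystem_iff.trans ((surjective_tfae (synthesis ξ)).out 0 2)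
  rw [hset]
  exact Units.isOpen.preimage <| continuous_synthesis.mul <|
    ContinuousLinearMap.adjoint.continuous.comp continuous_synthesis

end Synthesis

section GapShift

/-- The operator opening a gap of length `n` in the Fourier basis: `e_k ↦ e_{n+k}` for `k ≥ 0` and
`e_k ↦ e_k` for `k < 0`. -/
def gapShift (n : ℕ) : L2I →L[ℂ] L2I := modulation n * hardyProj + (1 - hardyProj)

theorem gapShift_apply_expBasis (n : ℕ) (k : ℤ) :
    gapShift n (expBasis k) = if 0 ≤ k then expBasis (n + k) else expBasis k := by
  have hmod : modulation n (expBasis k) = expBasis (n + k) :=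
    mod_cast modulation_apply_expBasis n k
  split_ifs with hk <;> simp [gapShift, hardyProj_apply_expBasis, hk, hmod]

theorem synthesis_comp_gapShift (ξ : ℝ) (n : ℕ) :
    synthesis (ξ + n) ∘L gapShift n = modulation n ∘L synthesis ξ := by
  refine ext_of_hilbertBasis expBasis fun k => ?_
  rw [ContinuousLinearMap.comp_apply, ContinuousLinearMap.comp_apply, gapShift_apply_expBasis,
    synthesis_apply_expBasis ξ, expSystem_apply]
  split_ifs with hk
  · rw [synthesis_apply_expBasis, expSystem_apply, if_pos (by positivity), modulation_apply_expVec]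
    push_cast
    rfl
  · rw [synthesis_apply_expBasis, expSystem_apply, if_neg hk, modulation_apply_expVec]
    ring_nf

theorem not_surjective_gapShift {n : ℕ} (hn : n ≠ 0) : ¬Function.Surjective (gapShift n) := by
  intro hsurj
  have hrange : (gapShift n).range ≤ (ℂ ∙ expBasis 0)ᗮ := by
    refine range_le_of_forall_hilbertBasis_mem expBasis (Submodule.isClosed_orthogonal _)
      fun k => Submodule.mem_orthogonal_singleton_iff_inner_right.2 ?_
    rw [gapShift_apply_expBasis]
    split_ifs with hk <;> exact expBasis.orthonormal.2 (by lia)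
  have hzero := Submodule.mem_orthogonal_singleton_iff_inner_right.1 (hrange (hsurj (expBasis 0)))
  exact expBasis.orthonormal.ne_zero 0 (inner_self_eq_zero.1 hzero)

/-- The subspace spanned by the exponentials `e^{2πikx}` with `0 ≤ k < n`, which the range of
`gapShift n` misses. -/
def gapSpan (n : ℕ) : Submodule ℂ L2I := Submodule.span ℂ (expBasis '' Set.Ico 0 (n : ℤ))

instance (n : ℕ) : FiniteDimensional ℂ (gapSpan n) :=
  .span_of_finite ℂ ((Set.finite_Ico _ _).image _)

theorem range_gapShift_sup_gapSpan (n : ℕ) : (gapShift n).range ⊔ gapSpan n = ⊤ := by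
  -- `R` is the adjoint of `gapShift n`, so `1 - gapShift n * R` projects onto the gap.
  set R := hardyProj * modulation (-n) + (1 - hardyProj)
  have hR : ∀ k, R (expBasis k)
      = hardyProj (expBasis (k - n)) + (expBasis k - hardyProj (expBasis k)) := fun k => by
    have hmod : modulation (-n) (expBasis k) = expBasis (k - n) := by
      simpa [sub_eq_neg_add] using modulation_apply_expBasis (-n) k
    simp [R, hmod]
  have hrange : (1 - gapShift n * R).range ≤ gapSpan n := by
    refine range_le_of_forall_hilbertBasis_mem expBasis (gapSpan n).closed_of_finiteDimensional
      fun k => ?_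
    rw [sub_apply, one_apply_eq_self, mul_apply_eq_comp, hR, hardyProj_apply_expBasis,
      hardyProj_apply_expBasis]
    rcases lt_or_ge k 0 with hneg | hnonneg
    · simp [hneg.not_ge, show ¬(n : ℤ) ≤ k by lia, gapShift_apply_expBasis]
    rcases lt_or_ge k n with hgap | hge
    · have hmem : expBasis k ∈ gapSpan n := Submodule.subset_span ⟨k, ⟨hnonneg, hgap⟩, rfl⟩
      simpa [hnonneg, hgap.not_ge] using hmem
    · simp [hnonneg, hge, gapShift_apply_expBasis]
  refine eq_top_iff.2 fun f _ => ?_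
  rw [← add_sub_cancel (gapShift n (R f)) f]
  exact Submodule.add_mem_sup ⟨R f, rfl⟩ (hrange ⟨f, rfl⟩)

variable {ξ : ℝ}

theorem denseRange_modulation_comp_synthesis (h : IsCompleteFamily (expSystem ξ)) (t : ℝ) :
    DenseRange (modulation t ∘L synthesis ξ) :=
  (bijective_modulation t).surjective.denseRange.comp (isCompleteFamily_expSystem_iff.1 h)
    (modulation t).continuous

theorem surjective_synthesis_comp_gapShift (h : IsFrame (expSystem ξ)) (n : ℕ) :
    Function.Surjective (synthesis (ξ + n) ∘ gapShift n) := by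
  rw [← ContinuousLinearMap.coe_comp, synthesis_comp_gapShift]
  exact (bijective_modulation n).surjective.comp (isFrame_expSystem_iff.1 h)

theorem IsCompleteFamily.expSystem_add_natCast (h : IsCompleteFamily (expSystem ξ)) (n : ℕ) :
    IsCompleteFamily (expSystem (ξ + n)) := by
  have hdense := denseRange_modulation_comp_synthesis h n
  rw [← synthesis_comp_gapShift] at hdense
  exact isCompleteFamily_expSystem_iff.2 (hdense.mono (Set.range_comp_subset_range _ _))

theorem IsFrame.expSystem_add_natCast (h : IsFrame (expSystem ξ)) (n : ℕ) :
    IsFrame (expSystem (ξ + n)) :=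
  isFrame_expSystem_iff.2 (surjective_synthesis_comp_gapShift h n).of_comp

theorem IsFrame.not_isRieszBasis_expSystem_add_natCast (h : IsFrame (expSystem ξ)) {n : ℕ}
    (hn : n ≠ 0) : ¬IsRieszBasis (expSystem (ξ + n)) := fun hRiesz =>
  not_surjective_gapShift hn <| (surjective_synthesis_comp_gapShift h n).of_comp_left
    (isRieszBasis_expSystem_iff.1 hRiesz).injective

theorem IsFrame.of_expSystem_add_natCast {n : ℕ} (h : IsFrame (expSystem (ξ + n)))
    (hcomplete : IsCompleteFamily (expSystem ξ)) : IsFrame (expSystem ξ) := by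
  have hsup : (modulation n ∘L synthesis ξ).range
      ⊔ (gapSpan n).map (synthesis (ξ + n)).toLinearMap = ⊤ := by
    rw [← synthesis_comp_gapShift, ContinuousLinearMap.toLinearMap_comp, LinearMap.range_comp,
      ← Submodule.map_sup, range_gapShift_sup_gapSpan, Submodule.map_top]
    exact LinearMap.range_eq_top.2 (isFrame_expSystem_iff.1 h)
  have hsurj : Function.Surjective (modulation n ∘ synthesis ξ) :=
    surjective_of_denseRange_of_range_sup_eq_top
      (denseRange_modulation_comp_synthesis hcomplete n) hsup
  exact isFrame_expSystem_iff.2 (hsurj.of_comp_left (bijective_modulation n).injective)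

end GapShift

section Incompleteness

theorem circleAverage_zero_one_eq_integral_expFun (F : ℂ → ℂ) :
    Real.circleAverage F 0 1 = ∫ x in (-1 / 2 : ℝ)..(1 / 2), F (expFun 1 x) := by
  have hperiodic : Function.Periodic (fun θ => F (circleMap 0 1 θ)) (2 * Real.pi) :=
    (periodic_circleMap 0 1).comp F
  have hshift := hperiodic.intervalIntegral_add_eq 0 (-Real.pi)
  rw [zero_add, show -Real.pi + 2 * Real.pi = Real.pi by ring] at hshift
  have hscale := intervalIntegral.integral_comp_mul_left (a := -1 / 2) (b := 1 / 2)
    (fun θ => F (circleMap 0 1 θ)) Real.two_pi_pos.ne'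
  rw [show 2 * Real.pi * (-1 / 2) = -Real.pi by ring, show 2 * Real.pi * (1 / 2) = Real.pi by ring]
    at hscale
  rw [Real.circleAverage_def, hshift, ← hscale]
  refine intervalIntegral.integral_congr fun x _ => ?_
  simp [circleMap_zero, expFun, mul_right_comm _ Complex.I]

theorem one_add_expFun (x : ℝ) :
    1 + expFun 1 x = ((2 * Real.cos (Real.pi * x) : ℝ) : ℂ) * expFun (1 / 2) x := by
  have hcos : ((2 * Real.cos (Real.pi * x) : ℝ) : ℂ) = expFun (1 / 2) x + expFun (-(1 / 2)) x := by
    rw [← conj_expFun, Complex.add_conj, re_expFun]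
    ring_nf
  rw [hcos, add_mul, ← expFun_add, ← expFun_add, neg_add_cancel, add_halves, expFun_zero, add_comm]

theorem expFun_cpow {t x : ℝ} (hx : |2 * t * x| < 1) (p : ℝ) :
    expFun t x ^ (p : ℂ) = expFun (p * t) x := by
  obtain ⟨hlower, hupper⟩ := abs_lt.1 hx
  have him : (2 * Real.pi * Complex.I * t * x).im = Real.pi * (2 * t * x) := by
    simp
    ring
  rw [expFun, Complex.cpow_def_of_ne_zero (Complex.exp_ne_zero _),
    Complex.log_exp (by rw [him]; nlinarith [Real.pi_pos]) (by rw [him]; nlinarith [Real.pi_pos]),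
    expFun]
  push_cast
  ring_nf

/-- The power `(2 cos πx)^p`, which is the modulus of `(1 + e^{2πix})^p` on `[-1/2, 1/2]`. -/
def cosPow (p x : ℝ) : ℂ := ((2 * Real.cos (Real.pi * x)) ^ p : ℝ)

theorem one_add_expFun_cpow {x : ℝ} (hx : |x| < 1 / 2) (p : ℝ) :
    (1 + expFun 1 x) ^ (p : ℂ) = cosPow p x * expFun (p / 2) x := by
  have hbase : 0 < 2 * Real.cos (Real.pi * x) := mul_pos two_pos (cos_pi_mul_pos hx)
  have hexp : expFun (1 / 2) x ≠ 0 := Complex.exp_ne_zero _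
  calc (1 + expFun 1 x) ^ (p : ℂ)
      = ((2 * Real.cos (Real.pi * x) : ℝ) : ℂ) ^ (p : ℂ) * expFun (1 / 2) x ^ (p : ℂ) := by
        rw [one_add_expFun,
          Complex.cpow_def_of_ne_zero (mul_ne_zero (Complex.ofReal_ne_zero.2 hbase.ne') hexp),
          Complex.log_ofReal_mul hbase hexp, Complex.ofReal_log hbase.le, add_mul, Complex.exp_add,
          ← Complex.cpow_def_of_ne_zero (Complex.ofReal_ne_zero.2 hbase.ne'),
          ← Complex.cpow_def_of_ne_zero hexp]
    _ = cosPow p x * expFun (p / 2) x := by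
        rw [← Complex.ofReal_cpow hbase.le, ← cosPow,
          expFun_cpow (by simpa using hx.trans (by norm_num)), mul_one_div]

theorem cosPow_neg (p x : ℝ) : cosPow p (-x) = cosPow p x := by
  rw [cosPow, mul_neg, Real.cos_neg, cosPow]

theorem continuous_cosPow {p : ℝ} (hp : 0 ≤ p) : Continuous (cosPow p) :=
  Complex.continuous_ofReal.comp <|
    (by fun_prop : Continuous fun x : ℝ => 2 * Real.cos (Real.pi * x)).rpow_const
      fun _ => .inr hp

theorem diffContOnCl_pow_mul_one_add_cpow {p : ℝ} (hp : 0 < p) (m : ℕ) :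
    DiffContOnCl ℂ (fun z : ℂ => z ^ m * (1 + z) ^ (p : ℂ)) (Metric.ball 0 1) := by
  have hre : ∀ z : ℂ, -‖z‖ ≤ z.re := fun z => (abs_le.1 (Complex.abs_re_le_norm z)).1
  refine ⟨fun z hz => ?_, fun z hz => ?_⟩
  · have hslit : 1 + z ∈ Complex.slitPlane :=
      .inl (by rw [Complex.add_re, Complex.one_re]; linarith [hre z, mem_ball_zero_iff.1 hz])
    exact (((differentiableAt_id.pow m).mul
      ((differentiableAt_id.const_add 1).cpow_const hslit))).differentiableWithinAt
  · rw [closure_ball 0 one_ne_zero, mem_closedBall_zero_iff] at hz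
    have hcpow : ContinuousAt (fun w : ℂ => w ^ (p : ℂ)) (1 + z) :=
      Complex.continuousAt_cpow_const_of_re_pos
        (.inl (by rw [Complex.add_re, Complex.one_re]; linarith [hre z])) (by simpa using hp)
    exact ((continuousAt_id.pow m).mul
      (hcpow.comp (continuousAt_const.add continuousAt_id))).continuousWithinAt

theorem expFun_one_pow (m : ℕ) (x : ℝ) : expFun 1 x ^ m = expFun m x := by
  rw [expFun, expFun, ← Complex.exp_nat_mul]
  push_cast
  ring_nf

theorem integral_cosPow_mul_expFun_eq_zero {p : ℝ} (hp : 0 < p) {m : ℕ} (hm : m ≠ 0) :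
    ∫ x in (-1 / 2 : ℝ)..(1 / 2), cosPow p x * expFun (p / 2 + m) x = 0 := by
  have hF : ∀ x ∈ Set.Ioo (-1 / 2 : ℝ) (1 / 2), cosPow p x * expFun (p / 2 + m) x
      = expFun 1 x ^ m * (1 + expFun 1 x) ^ (p : ℂ) := fun x hx => by
    rw [one_add_expFun_cpow (abs_lt.2 ⟨by linarith [hx.1], hx.2⟩), expFun_add,
      expFun_one_pow]
    ring
  calc ∫ x in (-1 / 2 : ℝ)..(1 / 2), cosPow p x * expFun (p / 2 + m) x
      = ∫ x in (-1 / 2 : ℝ)..(1 / 2), expFun 1 x ^ m * (1 + expFun 1 x) ^ (p : ℂ) := by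
        simp_rw [intervalIntegral.integral_of_le (by norm_num : (-1 / 2 : ℝ) ≤ 1 / 2),
          integral_Ioc_eq_integral_Ioo]
        exact setIntegral_congr_fun measurableSet_Ioo hF
    _ = Real.circleAverage (fun z => z ^ m * (1 + z) ^ (p : ℂ)) 0 1 :=
        (circleAverage_zero_one_eq_integral_expFun fun z => z ^ m * (1 + z) ^ (p : ℂ)).symm
    _ = 0 := by
        rw [DiffContOnCl.circleAverage (by simpa using diffContOnCl_pow_mul_one_add_cpow hp m)]
        simp [hm]

theorem integral_cosPow_mul_expFun_neg (p t : ℝ) :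
    ∫ x in (-1 / 2 : ℝ)..(1 / 2), cosPow p x * expFun (-t) x
      = ∫ x in (-1 / 2 : ℝ)..(1 / 2), cosPow p x * expFun t x := by
  have hneg := intervalIntegral.integral_comp_neg (a := -1 / 2) (b := 1 / 2)
    fun x => cosPow p x * expFun t x
  rw [show (-(-1 / 2) : ℝ) = 1 / 2 by norm_num, show (-(1 / 2) : ℝ) = -1 / 2 by norm_num] at hneg
  rw [← hneg]
  refine intervalIntegral.integral_congr fun x _ => ?_
  simp [cosPow_neg, expFun]

theorem memLp_cosPow {p : ℝ} (hp : 0 ≤ p) : MemLp (cosPow p) 2 μI := by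
  obtain ⟨C, hC⟩ := isCompact_Icc.exists_bound_of_continuousOn (continuous_cosPow hp).continuousOn
  refine MemLp.of_bound (continuous_cosPow hp).aestronglyMeasurable C ?_
  filter_upwards [ae_restrict_mem measurableSet_Icc] with x hx using hC x hx

theorem inner_expVec_windowedExp {g : ℝ → ℂ} (hg : MemLp g 2 μI) (s t : ℝ) :
    inner ℂ (expVec s) (windowedExp g hg t)
      = ∫ x in (-1 / 2 : ℝ)..(1 / 2), g x * expFun (t - s) x := by
  rw [inner_expVec, intervalIntegral.integral_of_le (by norm_num),
    intervalIntegral.integral_of_le (by norm_num), ← integral_Icc_eq_integral_Ioc,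
    ← integral_Icc_eq_integral_Ioc]
  refine integral_congr_ae ?_
  filter_upwards [coeFn_windowedExp g hg t] with x hx
  rw [hx, sub_eq_add_neg, expFun_add]
  ring

theorem windowedExp_cosPow_ne_zero {p : ℝ} (hp : 0 ≤ p) (t : ℝ) :
    windowedExp (cosPow p) (memLp_cosPow hp) t ≠ 0 := by
  intro hzero
  have hae : (fun x => cosPow p x * expFun t x) =ᵐ[μI] 0 := by
    filter_upwards [coeFn_windowedExp _ (memLp_cosPow hp) t, Lp.coeFn_zero ℂ 2 μI] with x hx hx0
    rw [← hx, hzero, hx0]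
  have heq := Measure.eqOn_Icc_of_ae_eq volume (by norm_num) hae
    ((continuous_cosPow hp).mul (continuous_expFun t)).continuousOn continuousOn_const
    (show (0 : ℝ) ∈ Set.Icc (-1 / 2) (1 / 2) by norm_num)
  have hpos : (0 : ℝ) < 2 ^ p := by positivity
  simp [cosPow, expFun, hpos.ne'] at heq

theorem not_isCompleteFamily_expSystem_of_lt_neg_one {ξ : ℝ} (hξ : ξ < -1) :
    ¬IsCompleteFamily (expSystem ξ) := by
  -- With `z = e^{2πix}`, the witness is `z^{-(p+1)} (1 + z)^p`: it is orthogonal to `z^{n-1-p}` for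
  -- `n < 0` because `z^m (1 + z)^p` vanishes at `0` for `m ≥ 1`, and substituting `-x` for `x`
  -- reduces the case `n ≥ 0` to this one, as the cosine is even.
  intro hcomplete
  obtain ⟨p, rfl⟩ : ∃ p, ξ = -1 - p := ⟨-1 - ξ, by ring⟩
  have hp : 0 < p := by linarith
  refine windowedExp_cosPow_ne_zero hp.le (-(p / 2 + 1)) (hcomplete _ fun n => ?_)
  rw [expSystem_apply]
  split_ifs with hn
  · obtain ⟨m, rfl⟩ := Int.eq_ofNat_of_zero_le hn
    rw [inner_expVec_windowedExp, ← integral_cosPow_mul_expFun_neg,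
      ← integral_cosPow_mul_expFun_eq_zero hp m.succ_ne_zero]
    push_cast
    ring_nf
  · obtain ⟨m, rfl⟩ := Int.eq_negSucc_of_lt_zero (not_le.1 hn)
    rw [inner_expVec_windowedExp, ← integral_cosPow_mul_expFun_eq_zero hp m.succ_ne_zero]
    push_cast
    ring_nf

theorem not_isCompleteFamily_expSystem_of_lt_neg_half {ξ : ℝ} (hξ : ξ < -1 / 2) :
    ¬IsCompleteFamily (expSystem ξ) := by
  rcases lt_or_ge ξ (-1) with hlt | hge
  · exact not_isCompleteFamily_expSystem_of_lt_neg_one hlt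
  intro hcomplete
  have hRiesz : IsRieszBasis (expSystem (ξ + (1 : ℕ))) :=
    isRieszBasis_expSystem_of_abs_lt (abs_lt.2 ⟨by push_cast; linarith, by push_cast; linarith⟩)
  exact (hRiesz.1.of_expSystem_add_natCast hcomplete).not_isRieszBasis_expSystem_add_natCast
    one_ne_zero hRiesz

theorem not_isFrame_expSystem_neg_half : ¬IsFrame (expSystem (-1 / 2)) := by
  intro hframe
  obtain ⟨ξ, hξ, hξ_frame⟩ :=
    (isOpen_setOf_isFrame_expSystem.eventually_mem hframe).exists_lt
  exact not_isCompleteFamily_expSystem_of_lt_neg_half hξ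
    (isCompleteFamily_expSystem_of_isFrame hξ_frame)

theorem isCompleteFamily_expSystem_neg_half : IsCompleteFamily (expSystem (-1 / 2)) :=
  isCompleteFamily_expSystem_of_abs_le (by norm_num [abs_le])

end Incompleteness

end WindowedExp

end

theorem mainTheorem2 (ξ : ℝ) :
    (ξ < -1 / 2 → ¬ WindowedExp.IsCompleteFamily (WindowedExp.expSystem ξ)) ∧
    (-1 / 2 < ξ → ξ < 1 / 2 → WindowedExp.IsRieszBasis (WindowedExp.expSystem ξ)) ∧
    (∀ n : ℕ, 1 ≤ n → -1 / 2 + (n : ℝ) < ξ → ξ < 1 / 2 + (n : ℝ) →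
      WindowedExp.IsFrame (WindowedExp.expSystem ξ) ∧
      ¬ WindowedExp.IsRieszBasis (WindowedExp.expSystem ξ)) ∧
    (∀ n : ℕ, ξ = -1 / 2 + (n : ℝ) →
      WindowedExp.IsCompleteFamily (WindowedExp.expSystem ξ) ∧
      ¬ WindowedExp.IsFrame (WindowedExp.expSystem ξ) ∧
      ¬ WindowedExp.IsRieszBasis (WindowedExp.expSystem ξ)) := by
  refine ⟨WindowedExp.not_isCompleteFamily_expSystem_of_lt_neg_half, fun hlower hupper => ?_,
    fun n hn hlower hupper => ?_, ?_⟩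
  · exact WindowedExp.isRieszBasis_expSystem_of_abs_lt (abs_lt.2 ⟨by linarith, hupper⟩)
  · obtain ⟨η, rfl⟩ : ∃ η, ξ = η + n := ⟨ξ - n, by ring⟩
    have hframe : WindowedExp.IsFrame (WindowedExp.expSystem η) :=
      (WindowedExp.isRieszBasis_expSystem_of_abs_lt
        (abs_lt.2 ⟨by linarith, by linarith⟩)).1
    exact ⟨hframe.expSystem_add_natCast n,
      hframe.not_isRieszBasis_expSystem_add_natCast (by lia)⟩
  · rintro n rfl
    have hcomplete := WindowedExp.isCompleteFamily_expSystem_neg_half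
    have hframe : ¬WindowedExp.IsFrame (WindowedExp.expSystem (-1 / 2 + n)) := fun h =>
      WindowedExp.not_isFrame_expSystem_neg_half (h.of_expSystem_add_natCast hcomplete)
    exact ⟨hcomplete.expSystem_add_natCast n, hframe, fun hRiesz => hframe hRiesz.1⟩
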